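/- Let $N \ge 2$ be an integer, let $B_1 = \{x \in \mathbb{R}^N : |x| < 1\}$ be the unit ball and $|B_1|$ its Lebesgue measure. For $0 < s < 1$ and a measurable set $E \subset \mathbb{R}^N$, define the fractional $s$-perimeter $$P_s(E) = \int_{\mathbb{R}^N}\int_{\mathbb{R}^N} \frac{|\mathbf 1_E(x) - \mathbf 1_E(y)|^2}{|x-y|^{N+2s}}\,dx\,dy \in [0,\infty].$$ Then for every $0 < s < 1/2$ the quantity $P_s(B_1)$ is finite and $$\frac{P_s(B_1)}{|B_1|^{\frac{N-2s}{N}}} = \frac{N\,\pi^{\frac N2 + s}\,\Gamma(1-2s)}{s\,\Gamma\left(\frac N2+1\right)^{\frac{2s}{N}}\,\Gamma(1-s)\,\Gamma\left(\frac{N+2-2s}{2}\right)},$$ while $P_s(B_1) = \infty$ for every $1/2 \le s < 1$. -/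

import Mathlib

open MeasureTheory

/-- The fractional `s`-perimeter of a set `E ⊆ ℝ^N`,
`P_s(E) = ∬ |1_E(x) - 1_E(y)|² / |x - y|^(N + 2s) dx dy`, with values in `[0, ∞]`. -/
noncomputable def fractionalPerimeter {N : ℕ} (s : ℝ) (E : Set (EuclideanSpace ℝ (Fin N))) :
    ENNReal :=
  ∫⁻ x : EuclideanSpace ℝ (Fin N), ∫⁻ y : EuclideanSpace ℝ (Fin N),
    ENNReal.ofReal
      (|E.indicator (fun _ => (1 : ℝ)) x - E.indicator (fun _ => (1 : ℝ)) y| ^ 2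
        / ‖x - y‖ ^ ((N : ℝ) + 2 * s))

/-!
Writing `y = x + z`, the fractional perimeter of the unit ball `B` of `ℝ^(n + 1)` is
`∫ ‖z‖ ^ (-(n + 1 + 2 s)) |B ∆ (B - z)| dz`. By reflection invariance `|B ∆ (B - z)|` depends on
`‖z‖` only. Slicing `B` by lines parallel to `z` gives chords of length `c(w) = 2 √(1 - ‖w‖ ^ 2)`,
`w` in the unit ball of `ℝ^n`, and an interval of length `c` differs from its translate by `r` in a
set of length `2 min(r, c)` (`volume_ball_symmDiff`). Polar coordinates in `z` and Tonelli's theorem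
yield (`fractionalPerimeter_ball_eq_lintegral`)

`P_s(B) = (n + 1) |B| ∫_{‖w‖ < 1} ∫_0^∞ r ^ (-1 - 2 s) 2 min(r, c(w)) dr dw`.

For `s ≥ 1 / 2` the inner integral diverges at `r = 0` for every `w`. For `s < 1 / 2` it equals
`c(w) ^ (1 - 2 s) / (s (1 - 2 s))`, and the remaining integral of `(1 - ‖w‖ ^ 2) ^ (1 / 2 - s)` over
the `n`-dimensional ball is a Beta integral by polar coordinates. Legendre's duplication formula
simplifies the resulting product of Gamma values.
-/

open Set Metric Module ProbabilityTheory
open scoped ENNReal Real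

/-! ### Polar coordinates -/

/-- Integration in polar coordinates for a radial function with values in `[0, ∞]`; the
Bochner-integral version is `MeasureTheory.integral_fun_norm_addHaar`. -/
theorem lintegral_fun_norm_addHaar {E : Type*} [NormedAddCommGroup E] [NormedSpace ℝ E]
    [FiniteDimensional ℝ E] [Nontrivial E] [MeasurableSpace E] [BorelSpace E]
    (μ : Measure E) [μ.IsAddHaarMeasure] {f : ℝ → ℝ≥0∞} (hf : Measurable f) :
    ∫⁻ x, f ‖x‖ ∂μ = finrank ℝ E * μ (ball 0 1) *
      ∫⁻ r in Ioi (0 : ℝ), ENNReal.ofReal (r ^ (finrank ℝ E - 1)) * f r := by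
  calc
    ∫⁻ x, f ‖x‖ ∂μ = ∫⁻ x : ({(0)}ᶜ : Set E), f ‖x.1‖ ∂(μ.comap (↑)) := by
      rw [lintegral_subtype_comap (measurableSet_singleton _).compl fun x ↦ f ‖x‖,
        restrict_compl_singleton]
    _ = ∫⁻ x, f x.2 ∂μ.toSphere.prod (.volumeIoiPow (finrank ℝ E - 1)) := by
      simpa using μ.measurePreserving_homeomorphUnitSphereProd.lintegral_comp_emb
        (Homeomorph.measurableEmbedding _) (f ∘ Subtype.val ∘ Prod.snd)
    _ = μ.toSphere univ * ∫⁻ x : Ioi (0 : ℝ), f x ∂.volumeIoiPow (finrank ℝ E - 1) := by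
      rw [lintegral_prod _ (by fun_prop)]
      simp [mul_comm]
    _ = _ := by
      rw [μ.toSphere_apply_univ, Measure.volumeIoiPow,
        lintegral_withDensity_eq_lintegral_mul _ (by fun_prop) (by fun_prop)]
      simp only [Pi.mul_apply]
      rw [lintegral_subtype_comap measurableSet_Ioi
        fun r ↦ ENNReal.ofReal (r ^ (finrank ℝ E - 1)) * f r]

/-! ### The symmetric difference of the ball with its translates -/

/-- Substituting `y = x + z` and integrating in `x` first, the perimeter becomes a weighted integral
of the measure of the symmetric difference of `E` with its translates. -/
theorem fractionalPerimeter_eq_lintegral_symmDiff {N : ℕ} (s : ℝ)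
    {E : Set (EuclideanSpace ℝ (Fin N))} (hE : MeasurableSet E) :
    fractionalPerimeter s E = ∫⁻ z : EuclideanSpace ℝ (Fin N),
      ENNReal.ofReal (‖z‖ ^ (-((N : ℝ) + 2 * s))) *
        volume (symmDiff E ((fun x ↦ x + z) ⁻¹' E)) := by
  have hmeas (z : EuclideanSpace ℝ (Fin N)) :
      MeasurableSet (symmDiff E ((fun x ↦ x + z) ⁻¹' E)) :=
    hE.symmDiff ((measurable_id.add_const z) hE)
  have hind : Measurable (E.indicator (fun _ => (1 : ℝ))) := measurable_const.indicator hE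
  unfold fractionalPerimeter
  calc
    _ = ∫⁻ x : EuclideanSpace ℝ (Fin N), ∫⁻ z : EuclideanSpace ℝ (Fin N),
        ENNReal.ofReal (‖z‖ ^ (-((N : ℝ) + 2 * s))) * ENNReal.ofReal
      (|E.indicator (fun _ => (1 : ℝ)) x - E.indicator (fun _ => (1 : ℝ)) (x + z)| ^ 2) := by
      refine lintegral_congr fun x ↦ ?_
      rw [← lintegral_add_left_eq_self _ x]
      refine lintegral_congr fun z ↦ ?_
      rw [← ENNReal.ofReal_mul (by positivity), Real.rpow_neg (norm_nonneg z), sub_add_cancel_left,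
        norm_neg, div_eq_inv_mul]
    _ = _ := by
      rw [lintegral_lintegral_swap (by fun_prop)]
      refine lintegral_congr fun z ↦ ?_
      rw [lintegral_const_mul _ (by fun_prop), ← lintegral_indicator_one (hmeas z)]
      congr 1
      refine lintegral_congr fun x ↦ ?_
      by_cases h1 : x ∈ E <;> by_cases h2 : x + z ∈ E <;>
        simp [Set.mem_symmDiff, h1, h2]

/-- The reflection exchanging `z` and `z'` preserves the ball, so only the length of the translation
matters. -/
theorem volume_ball_symmDiff_of_norm_eq {F : Type*} [NormedAddCommGroup F] [InnerProductSpace ℝ F]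
    [FiniteDimensional ℝ F] [MeasurableSpace F] [BorelSpace F] {z z' : F} (h : ‖z‖ = ‖z'‖) :
    volume (symmDiff (ball (0 : F) 1) ((fun x ↦ x + z) ⁻¹' ball 0 1)) =
      volume (symmDiff (ball (0 : F) 1) ((fun x ↦ x + z') ⁻¹' ball 0 1)) := by
  let e := Submodule.reflection (ℝ ∙ (z - z'))ᗮ
  have he : e z = z' := Submodule.reflection_sub h
  rw [eq_comm, ← e.measurePreserving.measure_preimage_equiv (f := e.toHomeomorph.toMeasurableEquiv)]
  congr 1
  ext x
  have hx : ‖e x + z'‖ = ‖x + z‖ := by rw [← he, ← map_add, e.norm_map]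
  change e x ∈ symmDiff (ball (0 : F) 1) ((fun x ↦ x + z') ⁻¹' ball 0 1) ↔ _
  simp only [Set.mem_symmDiff, mem_preimage, mem_ball_zero_iff, hx, e.norm_map]

theorem volume_Ioo_symmDiff_translate {a r : ℝ} (ha : 0 ≤ a) (hr : 0 ≤ r) :
    volume (symmDiff (Ioo (-a) a) ((fun t ↦ t + r) ⁻¹' Ioo (-a) a)) =
      ENNReal.ofReal (2 * min r (2 * a)) := by
  rw [preimage_add_const_Ioo]
  rcases lt_or_ge r (2 * a) with h | h
  -- The half-open intervals make the set identity exact, also for `r = 0`.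
  · have hU : symmDiff (Ioo (-a) a) (Ioo (-a - r) (a - r)) =
        Ioc (-a - r) (-a) ∪ Ico (a - r) a := by
      ext x
      simp only [Set.mem_symmDiff, mem_union, mem_Ioo, mem_Ioc, mem_Ico]
      grind
    rw [hU, measure_union _ measurableSet_Ico, Real.volume_Ioc, Real.volume_Ico,
      ← ENNReal.ofReal_add (by linarith) (by linarith), min_eq_left h.le]
    · congr 1; ring
    · exact Set.disjoint_left.2 fun x hx hy ↦ by
        simp only [mem_Ioc, mem_Ico] at hx hy; linarith
  · have hd : Disjoint (Ioo (-a) a) (Ioo (-a - r) (a - r)) :=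
      Set.disjoint_left.2 fun x hx hy ↦ by simp only [mem_Ioo] at hx hy; linarith
    rw [hd.symmDiff_eq_sup]
    change volume (_ ∪ _) = _
    rw [measure_union hd measurableSet_Ioo, Real.volume_Ioo,
      Real.volume_Ioo, ← ENNReal.ofReal_add (by linarith) (by linarith), min_eq_right h]
    congr 1; ring

theorem EuclideanSpace.measurePreserving_head_tail (n : ℕ) :
    MeasurePreserving (fun x : EuclideanSpace ℝ (Fin (n + 1)) ↦
      (x 0, (WithLp.toLp 2 (fun i ↦ x i.succ) : EuclideanSpace ℝ (Fin n)))) := by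
  have h := ((MeasurePreserving.id (volume : Measure ℝ)).prod
      (PiLp.volume_preserving_toLp (Fin n))).comp
    ((volume_preserving_piFinSuccAbove (fun _ ↦ ℝ) (0 : Fin (n + 1))).comp
      (PiLp.volume_preserving_ofLp (Fin (n + 1))))
  exact h

/-- Fubini along the direction of the translation: over a point `w` of the unit ball of the
orthogonal hyperplane, the ball is an interval of length `2 √(1 - ‖w‖ ^ 2)`. -/
theorem volume_ball_symmDiff {n : ℕ} {z : EuclideanSpace ℝ (Fin (n + 1))} :
    volume (symmDiff (ball 0 1) ((fun x ↦ x + z) ⁻¹' ball 0 1)) =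
      ∫⁻ w in ball (0 : EuclideanSpace ℝ (Fin n)) 1,
        ENNReal.ofReal (2 * min ‖z‖ (2 * √(1 - ‖w‖ ^ 2))) := by
  let A (r : ℝ) : Set (ℝ × EuclideanSpace ℝ (Fin n)) := {p | (p.1 + r) ^ 2 + ‖p.2‖ ^ 2 < 1}
  have hA (r : ℝ) : MeasurableSet (A r) := measurableSet_lt (by fun_prop) (by fun_prop)
  have hz : ‖z‖ = ‖EuclideanSpace.single (0 : Fin (n + 1)) ‖z‖‖ := by simp
  have key (x : EuclideanSpace ℝ (Fin (n + 1))) (r : ℝ) :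
      ‖x + EuclideanSpace.single (0 : Fin (n + 1)) r‖ < 1 ↔ (x 0 + r) ^ 2 +
        ‖(WithLp.toLp 2 (fun i ↦ x i.succ) : EuclideanSpace ℝ (Fin n))‖ ^ 2 < 1 := by
    rw [← sq_lt_one_iff₀ (norm_nonneg _), EuclideanSpace.norm_sq_eq, EuclideanSpace.norm_sq_eq,
      Fin.sum_univ_succ]
    simp
  have hpre : symmDiff (ball (0 : EuclideanSpace ℝ (Fin (n + 1))) 1)
      ((fun x ↦ x + EuclideanSpace.single (0 : Fin (n + 1)) ‖z‖) ⁻¹' ball 0 1) =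
      (fun x : EuclideanSpace ℝ (Fin (n + 1)) ↦
      (x 0, (WithLp.toLp 2 (fun i ↦ x i.succ) : EuclideanSpace ℝ (Fin n)))) ⁻¹'
        (symmDiff (A 0) (A ‖z‖)) := by
    ext x
    have h0 := key x 0
    rw [show EuclideanSpace.single (0 : Fin (n + 1)) (0 : ℝ) = 0 from
      (PiLp.single_eq_zero_iff 2 _).2 rfl, add_zero] at h0
    simp only [Set.mem_symmDiff, mem_preimage, mem_ball_zero_iff, A, mem_ofPred_eq, key, h0]
  rw [volume_ball_symmDiff_of_norm_eq hz, hpre,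
    (EuclideanSpace.measurePreserving_head_tail n).measure_preimage
      ((hA 0).symmDiff (hA _)).nullMeasurableSet, Measure.volume_eq_prod,
    Measure.prod_apply_symm ((hA 0).symmDiff (hA _)), ← lintegral_indicator measurableSet_ball]
  refine lintegral_congr fun w ↦ ?_
  by_cases hw : ‖w‖ < 1
  · have hw' : 0 < 1 - ‖w‖ ^ 2 := by nlinarith [norm_nonneg w]
    rw [indicator_of_mem (by simpa using hw),
      ← volume_Ioo_symmDiff_translate (Real.sqrt_nonneg _) (norm_nonneg z)]
    congr 1
    ext t
    have (u : ℝ) : u ^ 2 + ‖w‖ ^ 2 < 1 ↔ -√(1 - ‖w‖ ^ 2) < u ∧ u < √(1 - ‖w‖ ^ 2) := by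
      rw [← lt_sub_iff_add_lt, ← abs_lt, ← sq_abs, Real.lt_sqrt (abs_nonneg u)]
    simp only [Set.mem_symmDiff, mem_preimage, A, mem_ofPred_eq, this, mem_Ioo, add_zero]
  · rw [indicator_of_notMem (by simpa using hw)]
    have (u : ℝ) : ¬ (u ^ 2 + ‖w‖ ^ 2 < 1) := by nlinarith [norm_nonneg w, sq_nonneg u]
    convert measure_empty (μ := volume)
    ext t
    simp [A, this]

/-! ### One-dimensional integrals -/

theorem setLIntegral_ofReal_rpow_mul_min {s c : ℝ} (hs : 0 < s) (hs' : s < 1 / 2) (hc : 0 < c) :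
    ∫⁻ r in Ioi (0 : ℝ), ENNReal.ofReal (r ^ (-1 - 2 * s)) * ENNReal.ofReal (2 * min r c) =
      ENNReal.ofReal (c ^ (1 - 2 * s) / (s * (1 - 2 * s))) := by
  have hle : ∫⁻ r in Ioc 0 c, ENNReal.ofReal (r ^ (-1 - 2 * s)) * ENNReal.ofReal (2 * min r c) =
      ENNReal.ofReal (2 * (c ^ (1 - 2 * s) / (1 - 2 * s))) := by
    have hint : IntervalIntegrable (fun r : ℝ ↦ 2 * r ^ (-2 * s)) volume 0 c :=
      (intervalIntegral.intervalIntegrable_rpow' (by linarith)).const_mul 2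
    have hval : ∫ r in Ioc 0 c, 2 * r ^ (-2 * s) = 2 * (c ^ (1 - 2 * s) / (1 - 2 * s)) := by
      rw [← intervalIntegral.integral_of_le hc.le, intervalIntegral.integral_const_mul,
        integral_rpow (Or.inl (by linarith)), Real.zero_rpow (by linarith)]
      ring_nf
    rw [← hval, ofReal_integral_eq_lintegral_ofReal hint.1]
    · refine setLIntegral_congr_fun measurableSet_Ioc fun r hr ↦ ?_
      have hr0 : 0 < r := hr.1
      rw [← ENNReal.ofReal_mul (by positivity), min_eq_left hr.2,
        show -1 - 2 * s = -2 * s - 1 by ring, Real.rpow_sub_one hr0.ne']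
      congr 1
      field_simp
    · filter_upwards [ae_restrict_mem measurableSet_Ioc] with r hr
      have hr0 : 0 < r := hr.1
      simp only [Pi.zero_apply]
      positivity
  have hgt : ∫⁻ r in Ioi c, ENNReal.ofReal (r ^ (-1 - 2 * s)) * ENNReal.ofReal (2 * min r c) =
      ENNReal.ofReal (c ^ (1 - 2 * s) / s) := by
    have hint : IntegrableOn (fun r : ℝ ↦ 2 * c * r ^ (-1 - 2 * s)) (Ioi c) :=
      (integrableOn_Ioi_rpow_of_lt (by linarith) hc).const_mul _
    have hval : ∫ r in Ioi c, 2 * c * r ^ (-1 - 2 * s) = c ^ (1 - 2 * s) / s := by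
      rw [integral_const_mul, integral_Ioi_rpow_of_lt (by linarith) hc,
        show 1 - 2 * s = -1 - 2 * s + 1 + 1 by ring, Real.rpow_add_one hc.ne' (-1 - 2 * s + 1),
        show -1 - 2 * s + 1 = -(2 * s) by ring]
      field_simp
    rw [← hval, ofReal_integral_eq_lintegral_ofReal hint]
    · refine setLIntegral_congr_fun measurableSet_Ioi fun r hr ↦ ?_
      have hr0 : 0 < r := hc.trans hr
      rw [← ENNReal.ofReal_mul (by positivity), min_eq_right (le_of_lt hr), mul_comm]
    · filter_upwards [ae_restrict_mem measurableSet_Ioi] with r hr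
      have hr0 : 0 < r := hc.trans hr
      simp only [Pi.zero_apply]
      positivity
  have h1 : 0 < 1 - 2 * s := by linarith
  rw [← Ioc_union_Ioi_eq_Ioi hc.le, lintegral_union measurableSet_Ioi Ioc_disjoint_Ioi_same,
    hle, hgt, ← ENNReal.ofReal_add (by positivity) (by positivity)]
  congr 1
  field_simp
  ring

/-- For `s ≥ 1 / 2` the integrand is `2 r ^ (-2 s)` near `0`, which is not integrable there. -/
theorem setLIntegral_ofReal_rpow_mul_min_eq_top {s c : ℝ} (hs : 1 / 2 ≤ s) (hc : 0 < c) :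
    ∫⁻ r in Ioi (0 : ℝ), ENNReal.ofReal (r ^ (-1 - 2 * s)) * ENNReal.ofReal (2 * min r c) = ⊤ := by
  have hnot : ¬ IntegrableOn (fun r : ℝ ↦ r ^ (-2 * s)) (Ioo 0 c) := by
    rw [intervalIntegral.integrableOn_Ioo_rpow_iff hc]
    linarith
  have htop : ∫⁻ r in Ioo 0 c, ENNReal.ofReal (r ^ (-2 * s)) = ⊤ := by
    by_contra h
    refine hnot ⟨by fun_prop, ?_⟩
    rw [hasFiniteIntegral_iff_ofReal]
    · exact lt_top_iff_ne_top.2 h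
    · filter_upwards [ae_restrict_mem measurableSet_Ioo] with r hr
      exact Real.rpow_nonneg hr.1.le _
  refine top_unique (htop.symm.le.trans ?_)
  refine (setLIntegral_mono' measurableSet_Ioo fun r hr ↦ ?_).trans
    (lintegral_mono_set Ioo_subset_Ioi_self)
  have hr0 : 0 < r := hr.1
  rw [← ENNReal.ofReal_mul (by positivity), min_eq_left hr.2.le,
    show -1 - 2 * s = -2 * s - 1 by ring, Real.rpow_sub_one hr0.ne']
  refine ENNReal.ofReal_le_ofReal ?_
  have := Real.rpow_nonneg hr0.le (-2 * s)
  field_simp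
  linarith

theorem setLIntegral_rpow_mul_one_sub_rpow {α β : ℝ} (hα : 0 < α) (hβ : 0 < β) :
    ∫⁻ x in Ioo (0 : ℝ) 1, ENNReal.ofReal (x ^ (α - 1) * (1 - x) ^ (β - 1)) =
      ENNReal.ofReal (beta α β) := by
  have hb := beta_pos hα hβ
  rw [← mul_one (ENNReal.ofReal (beta α β)), ← lintegral_betaPDF_eq_one hα hβ, lintegral_betaPDF,
    ← lintegral_const_mul _ (by fun_prop)]
  refine lintegral_congr fun x ↦ ?_
  rw [← ENNReal.ofReal_mul hb.le]
  congr 1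
  field_simp

/-- The substitution `x = r ^ 2` turns this into a Beta integral. -/
theorem setLIntegral_pow_mul_one_sub_sq_rpow {m : ℕ} (hm : 0 < m) {b : ℝ} (hb : -1 < b) :
    ∫⁻ r in Ioo (0 : ℝ) 1, ENNReal.ofReal (r ^ (m - 1)) * ENNReal.ofReal ((1 - r ^ 2) ^ b) =
      ENNReal.ofReal (beta (m / 2) (b + 1) / 2) := by
  have himage : (fun r : ℝ ↦ r ^ 2) '' Ioo 0 1 = Ioo 0 1 := by
    ext x
    constructor
    · rintro ⟨r, ⟨h0, h1⟩, rfl⟩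
      exact ⟨by positivity, by simp only; nlinarith⟩
    · rintro ⟨h0, h1⟩
      exact ⟨√x, ⟨Real.sqrt_pos.2 h0, by rwa [Real.sqrt_lt' one_pos, one_pow]⟩,
        Real.sq_sqrt h0.le⟩
  have hinj : InjOn (fun r : ℝ ↦ r ^ 2) (Ioo 0 1) := fun x hx y hy h ↦
    (sq_eq_sq₀ hx.1.le hy.1.le).1 h
  have hcv := lintegral_image_eq_lintegral_abs_deriv_mul (f := fun r : ℝ ↦ r ^ 2)
    (f' := fun r ↦ 2 * r) measurableSet_Ioo
    (fun r _ ↦ by simpa using (hasDerivAt_pow 2 r).hasDerivWithinAt) hinj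
    (fun x ↦ ENNReal.ofReal (x ^ ((m : ℝ) / 2 - 1) * (1 - x) ^ (b + 1 - 1)))
  rw [himage, setLIntegral_rpow_mul_one_sub_rpow (by positivity) (by linarith)] at hcv
  rw [ENNReal.ofReal_div_of_pos two_pos, hcv, ENNReal.ofReal_ofNat,
    ENNReal.eq_div_iff (by simp) (by simp), ← lintegral_const_mul _ (by fun_prop)]
  refine setLIntegral_congr_fun measurableSet_Ioo fun r hr ↦ ?_
  have hr0 : 0 < r := hr.1
  have hpow : (r ^ 2) ^ ((m : ℝ) / 2 - 1) * r = r ^ (m - 1) := by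
    rw [← Real.rpow_natCast r 2, ← Real.rpow_mul hr0.le, ← Real.rpow_add_one hr0.ne',
      ← Real.rpow_natCast, Nat.cast_pred hm]
    congr 1
    push_cast
    ring
  rw [← ENNReal.ofReal_ofNat 2, ← ENNReal.ofReal_mul (by positivity),
    ← ENNReal.ofReal_mul (by positivity), ← ENNReal.ofReal_mul (by positivity),
    abs_of_pos (by positivity), ← hpow, add_sub_cancel_right]
  congr 1
  ring

theorem setLIntegral_ball_one_sub_norm_sq_rpow {F : Type*} [NormedAddCommGroup F]
    [NormedSpace ℝ F] [FiniteDimensional ℝ F] [Nontrivial F] [MeasurableSpace F] [BorelSpace F]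
    (μ : Measure F) [μ.IsAddHaarMeasure] {b : ℝ} (hb : -1 < b) :
    ∫⁻ w in ball (0 : F) 1, ENNReal.ofReal ((1 - ‖w‖ ^ 2) ^ b) ∂μ =
      finrank ℝ F * μ (ball 0 1) *
        ENNReal.ofReal (beta (finrank ℝ F / 2) (b + 1) / 2) := by
  have hf : Measurable ((Iio (1 : ℝ)).indicator fun r ↦ ENNReal.ofReal ((1 - r ^ 2) ^ b)) :=
    Measurable.indicator (by fun_prop) measurableSet_Iio
  have hball (w : F) : (ball (0 : F) 1).indicator
      (fun w ↦ ENNReal.ofReal ((1 - ‖w‖ ^ 2) ^ b)) w =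
      (Iio (1 : ℝ)).indicator (fun r ↦ ENNReal.ofReal ((1 - r ^ 2) ^ b)) ‖w‖ := by
    simp [indicator]
  rw [← lintegral_indicator measurableSet_ball]
  simp_rw [hball]
  rw [lintegral_fun_norm_addHaar μ hf, ← setLIntegral_pow_mul_one_sub_sq_rpow finrank_pos hb]
  simp_rw [← Set.indicator_mul_right (Iio (1 : ℝ))
    (fun r : ℝ ↦ ENNReal.ofReal (r ^ (finrank ℝ F - 1)))]
  rw [setLIntegral_indicator measurableSet_Iio, inter_comm, Ioi_inter_Iio]

/-! ### The perimeter of the ball -/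

/-- The perimeter of the ball as an integral over the unit ball of a hyperplane: polar coordinates
in the translation `z`, with the radial integration moved inside the integration over the chords. -/
theorem fractionalPerimeter_ball_eq_lintegral {n : ℕ} (s : ℝ) :
    fractionalPerimeter s (ball (0 : EuclideanSpace ℝ (Fin (n + 1))) 1) =
      (n + 1 : ℕ) * volume (ball (0 : EuclideanSpace ℝ (Fin (n + 1))) 1) *
        ∫⁻ w in ball (0 : EuclideanSpace ℝ (Fin n)) 1, ∫⁻ r in Ioi (0 : ℝ),
          ENNReal.ofReal (r ^ (-1 - 2 * s)) *
            ENNReal.ofReal (2 * min r (2 * √(1 - ‖w‖ ^ 2))) := by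
  rw [fractionalPerimeter_eq_lintegral_symmDiff s measurableSet_ball]
  simp_rw [volume_ball_symmDiff]
  rw [lintegral_fun_norm_addHaar volume
    (f := fun r ↦ ENNReal.ofReal (r ^ (-(((n + 1 : ℕ) : ℝ) + 2 * s))) *
      ∫⁻ w in ball (0 : EuclideanSpace ℝ (Fin n)) 1,
        ENNReal.ofReal (2 * min r (2 * √(1 - ‖w‖ ^ 2)))) (by fun_prop),
    finrank_euclideanSpace_fin, lintegral_lintegral_swap (by fun_prop)]
  congr 1
  refine setLIntegral_congr_fun measurableSet_Ioi fun r hr ↦ ?_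
  have hr0 : 0 < r := hr
  rw [lintegral_const_mul _ (by fun_prop), ← mul_assoc, ← ENNReal.ofReal_mul (by positivity),
    ← Real.rpow_natCast, ← Real.rpow_add hr0]
  congr 3
  push_cast [Nat.add_sub_cancel]
  ring

theorem fractionalPerimeter_ball_eq_top {n : ℕ} {s : ℝ} (hs : 1 / 2 ≤ s) :
    fractionalPerimeter s (ball (0 : EuclideanSpace ℝ (Fin (n + 1))) 1) = ⊤ := by
  have hsqrt {w : EuclideanSpace ℝ (Fin n)} (hw : w ∈ ball 0 1) :
      0 < 2 * √(1 - ‖w‖ ^ 2) := by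
    rw [mem_ball_zero_iff] at hw
    have := Real.sqrt_pos.2 (show 0 < 1 - ‖w‖ ^ 2 by nlinarith [norm_nonneg w])
    positivity
  rw [fractionalPerimeter_ball_eq_lintegral,
    setLIntegral_congr_fun (g := fun _ ↦ ⊤) measurableSet_ball fun w hw ↦
      setLIntegral_ofReal_rpow_mul_min_eq_top hs (hsqrt hw),
    setLIntegral_const, ENNReal.top_mul (measure_ball_pos volume _ one_pos).ne',
    ENNReal.mul_top (mul_ne_zero (by simp) (measure_ball_pos volume _ one_pos).ne')]

/-- Legendre's duplication formula at `1 / 2 - s` brings the constant to its final form. On the left,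
`√π ^ n / Γ(n / 2 + 1)` is the volume of the `n`-dimensional unit ball. -/
theorem ball_constant_eq_Gamma_quotient {n s : ℝ} (hn : 0 < n) (hs : 0 < s) (hs' : s < 1 / 2) :
    2 ^ (1 - 2 * s) / (s * (1 - 2 * s)) *
        (n * (√π ^ n / Real.Gamma (n / 2 + 1)) * (beta (n / 2) (1 / 2 - s + 1) / 2)) =
      π ^ ((n + 1) / 2) * Real.Gamma (1 - 2 * s) /
        (s * Real.Gamma (1 - s) * Real.Gamma ((n + 1 + 2 - 2 * s) / 2)) := by
  have hdup := Real.Gamma_mul_Gamma_add_half (1 / 2 - s)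
  rw [show 1 / 2 - s + 1 / 2 = 1 - s by ring, show 2 * (1 / 2 - s) = 1 - 2 * s by ring,
    sub_sub_cancel] at hdup
  have hG1 : 0 < Real.Gamma (1 - s) := Real.Gamma_pos_of_pos (by linarith)
  have hG2 : 0 < Real.Gamma (n / 2) := Real.Gamma_pos_of_pos (by linarith)
  have hG3 : 0 < Real.Gamma ((n + 1 + 2 - 2 * s) / 2) := Real.Gamma_pos_of_pos (by linarith)
  have h2 : (2 : ℝ) ^ (1 - 2 * s) * 2 ^ (2 * s) = 2 := by
    rw [← Real.rpow_add two_pos]; norm_num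
  have hpi : π ^ ((n + 1) / 2) = √π ^ n * √π := by
    rw [← Real.rpow_add_one (by positivity), Real.sqrt_eq_rpow, ← Real.rpow_mul Real.pi_pos.le]
    ring_nf
  have h1 : 1 - 2 * s ≠ 0 := by linarith
  rw [beta, Real.Gamma_add_one (by positivity), Real.Gamma_add_one (s := 1 / 2 - s) (by linarith),
    show n / 2 + (1 / 2 - s + 1) = (n + 1 + 2 - 2 * s) / 2 by ring, hpi,
    eq_div_of_mul_eq hG1.ne' hdup]
  field_simp
  linear_combination Real.Gamma (1 - 2 * s) * h2

theorem fractionalPerimeter_ball {n : ℕ} (hn : 0 < n) {s : ℝ} (hs : 0 < s) (hs' : s < 1 / 2) :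
    fractionalPerimeter s (ball (0 : EuclideanSpace ℝ (Fin (n + 1))) 1) =
      volume (ball (0 : EuclideanSpace ℝ (Fin (n + 1))) 1) * ENNReal.ofReal
        ((n + 1) * (π ^ (((n : ℝ) + 1) / 2) * Real.Gamma (1 - 2 * s) /
          (s * Real.Gamma (1 - s) * Real.Gamma (((n : ℝ) + 1 + 2 - 2 * s) / 2)))) := by
  have : Nonempty (Fin n) := ⟨⟨0, hn⟩⟩
  have h1 : 0 < 1 - 2 * s := by linarith
  have hfiber (w : EuclideanSpace ℝ (Fin n)) (hw : w ∈ ball 0 1) :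
      ∫⁻ r in Ioi (0 : ℝ), ENNReal.ofReal (r ^ (-1 - 2 * s)) *
            ENNReal.ofReal (2 * min r (2 * √(1 - ‖w‖ ^ 2))) =
        ENNReal.ofReal (2 ^ (1 - 2 * s) / (s * (1 - 2 * s))) *
          ENNReal.ofReal ((1 - ‖w‖ ^ 2) ^ (1 / 2 - s)) := by
    rw [mem_ball_zero_iff] at hw
    have hw' : 0 < 1 - ‖w‖ ^ 2 := by nlinarith [norm_nonneg w]
    have hsq := Real.sqrt_pos.2 hw'
    rw [setLIntegral_ofReal_rpow_mul_min hs hs' (by positivity),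
      ← ENNReal.ofReal_mul (by positivity), Real.mul_rpow two_pos.le hsq.le, Real.sqrt_eq_rpow,
      ← Real.rpow_mul hw'.le, show 1 / 2 * (1 - 2 * s) = 1 / 2 - s by ring]
    congr 1
    ring
  have hb : 0 < beta ((n : ℝ) / 2) (1 / 2 - s + 1) := beta_pos (by positivity) (by linarith)
  have hG : 0 < Real.Gamma ((n : ℝ) / 2 + 1) := Real.Gamma_pos_of_pos (by positivity)
  rw [fractionalPerimeter_ball_eq_lintegral, setLIntegral_congr_fun measurableSet_ball hfiber,
    lintegral_const_mul _ (by fun_prop),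
    setLIntegral_ball_one_sub_norm_sq_rpow volume (by linarith), finrank_euclideanSpace_fin,
    EuclideanSpace.volume_ball (ι := Fin n), Fintype.card_fin, ENNReal.ofReal_one, one_pow, one_mul,
    ← ball_constant_eq_Gamma_quotient (by positivity) hs hs', Real.rpow_natCast,
    ← ENNReal.ofReal_natCast n, ← ENNReal.ofReal_mul (by positivity),
    ← ENNReal.ofReal_mul (by positivity), ← ENNReal.ofReal_mul (by positivity),
    ENNReal.ofReal_mul (p := (n : ℝ) + 1) (by positivity), ← Nat.cast_add_one,
    ENNReal.ofReal_natCast]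
  ring

theorem proposition1 (N : ℕ) (hN : 2 ≤ N) :
    (∀ s : ℝ, 0 < s → s < 1 / 2 →
      fractionalPerimeter s (Metric.ball (0 : EuclideanSpace ℝ (Fin N)) 1)
          / volume (Metric.ball (0 : EuclideanSpace ℝ (Fin N)) 1) ^ (((N : ℝ) - 2 * s) / (N : ℝ))
        = ENNReal.ofReal
            ((N : ℝ) * Real.pi ^ ((N : ℝ) / 2 + s) * Real.Gamma (1 - 2 * s)
              / (s * Real.Gamma ((N : ℝ) / 2 + 1) ^ (2 * s / (N : ℝ)) * Real.Gamma (1 - s)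
                  * Real.Gamma (((N : ℝ) + 2 - 2 * s) / 2)))) ∧
    (∀ s : ℝ, 1 / 2 ≤ s → s < 1 →
      fractionalPerimeter s (Metric.ball (0 : EuclideanSpace ℝ (Fin N)) 1) = ⊤) := by
  obtain ⟨n, rfl⟩ : ∃ n, N = n + 1 := ⟨N - 1, by omega⟩
  refine ⟨fun s hs hs' ↦ ?_, fun s hs _ ↦ fractionalPerimeter_ball_eq_top hs⟩
  have hN0 : (0 : ℝ) < (n + 1 : ℕ) := by positivity
  have hG0 : 0 < Real.Gamma (((n + 1 : ℕ) : ℝ) / 2 + 1) := Real.Gamma_pos_of_pos (by positivity)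
  have hG1 : 0 < Real.Gamma (1 - 2 * s) := Real.Gamma_pos_of_pos (by linarith)
  have hG2 : 0 < Real.Gamma (1 - s) := Real.Gamma_pos_of_pos (by linarith)
  have hG3 : 0 < Real.Gamma ((((n + 1 : ℕ) : ℝ) + 2 - 2 * s) / 2) :=
    Real.Gamma_pos_of_pos (by linarith)
  have hV : 0 < √π ^ (n + 1) / Real.Gamma (((n + 1 : ℕ) : ℝ) / 2 + 1) := by positivity
  -- `V = V ^ ((N - 2 s) / N) * V ^ (2 s / N)` for the volume `V` of the ball.
  have hsplit : (√π ^ (n + 1) / Real.Gamma (((n + 1 : ℕ) : ℝ) / 2 + 1)) =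
      (√π ^ (n + 1) / Real.Gamma (((n + 1 : ℕ) : ℝ) / 2 + 1)) ^
        ((((n + 1 : ℕ) : ℝ) - 2 * s) / ((n + 1 : ℕ) : ℝ)) *
      (π ^ s / Real.Gamma (((n + 1 : ℕ) : ℝ) / 2 + 1) ^ (2 * s / ((n + 1 : ℕ) : ℝ))) := by
    have hpow : (√π ^ (n + 1)) ^ (2 * s / ((n + 1 : ℕ) : ℝ)) = π ^ s := by
      rw [← Real.rpow_natCast, ← Real.rpow_mul (by positivity), Real.sqrt_eq_rpow,
        ← Real.rpow_mul Real.pi_pos.le]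
      congr 1
      field_simp
    rw [← hpow, ← Real.div_rpow (by positivity) hG0.le, ← Real.rpow_add hV, ← add_div,
      sub_add_cancel, div_self hN0.ne', Real.rpow_one]
  rw [fractionalPerimeter_ball (by omega) hs hs', EuclideanSpace.volume_ball, Fintype.card_fin,
    ENNReal.ofReal_one, one_pow, one_mul, ENNReal.ofReal_rpow_of_pos hV,
    ← ENNReal.ofReal_mul hV.le, ← ENNReal.ofReal_div_of_pos (by positivity)]
  congr 1
  rw [div_eq_iff (by positivity)]
  nth_rw 1 [hsplit]
  rw [Real.rpow_add Real.pi_pos, ← Nat.cast_add_one]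
  field_simp
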